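/- Let $\mathbb{D}$ be the open unit disk and $\mathbb{T}$ the unit circle with normalized arc length; $L^2=L^2(\mathbb{T})$, $L^\infty=L^\infty(\mathbb{T})$. Let $H^2\subset L^2$ be the subspace of functions whose Fourier coefficients of negative index vanish, and let $H^\infty\subset L^\infty$ be the space of boundary functions (a.e. radial limits) of bounded holomorphic functions on $\mathbb{D}$; each $\varphi\in H^\infty$ is identified with its bounded holomorphic extension to $\mathbb{D}$, so that $\varphi(\mathbb{D})$ denotes the image of $\mathbb{D}$ under this extension. Let $\theta$ be an inner function, i.e. $\theta\in H^\infty$ and $|\theta|=1$ a.e. on $\mathbb{T}$, let $K_\theta=H^2\ominus\theta H^2$ be its model space, and let $Q_\theta$ be the orthogonal projection of $L^2$ onto $(K_\theta)^\perp=L^2\ominus K_\theta$. For $\varphi\in L^\infty$, the dual truncated Toeplitz operator $D_\varphi^\theta$ is the bounded operator on $(K_\theta)^\perp$ given by $D_\varphi^\theta f=Q_\theta(\varphi f)$. If $\varphi\in H^\infty$ and $\bar\theta\varphi\in\overline{H^\infty}=\{\bar h: h\in H^\infty\}$, then the spectrum of $D_\varphi^\theta$, as a bounded operator on $(K_\theta)^\perp$,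 is $$\sigma(D_\varphi^\theta)=\operatorname{clos}\varphi(\mathbb{D}).$$ -/

import Mathlib

open MeasureTheory Filter Topology
open scoped ENNReal ComplexConjugate

noncomputable section

/-- The unit circle `𝕋`, parametrized as `ℝ / ℤ` through `t ↦ exp (2 π i t)`
(this map is `AddCircle.toCircle`). -/
abbrev UCirc : Type := AddCircle (1 : ℝ)

/-- Normalized arc length measure on the circle. -/
abbrev arcMeasure : Measure UCirc := AddCircle.haarAddCircle

/-- `L² = L²(𝕋)`. -/
abbrev L2T : Type := Lp ℂ 2 arcMeasure

/-- `L^∞ = L^∞(𝕋)`. -/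
abbrev LinfT : Type := Lp ℂ ∞ arcMeasure

/-- `F` is a bounded holomorphic function on the open unit disk and `g` is its boundary function
on `𝕋`: the radial limits of `F` exist and equal `g` almost everywhere. -/
structure IsHinfExtension (F : ℂ → ℂ) (g : UCirc → ℂ) : Prop where
  holomorphic : DifferentiableOn ℂ F (Metric.ball 0 1)
  bounded : ∃ C : ℝ, ∀ z ∈ Metric.ball (0 : ℂ) 1, ‖F z‖ ≤ C
  radial_limit : ∀ᵐ t ∂arcMeasure,
    Tendsto (fun r : ℝ => F (r * (AddCircle.toCircle t : ℂ))) (𝓝[<] 1) (𝓝 (g t))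

/-- `g` (a function on `𝕋`, considered up to null sets) belongs to `H^∞`, the space of boundary
functions of bounded holomorphic functions on the disk. -/
def MemHinf (g : UCirc → ℂ) : Prop := ∃ F : ℂ → ℂ, IsHinfExtension F g

/-- `g` belongs to the space of complex conjugates of functions in `H^∞`. -/
def MemConjHinf (g : UCirc → ℂ) : Prop := MemHinf fun t => conj (g t)

/-- Inner functions: elements of `H^∞` that are unimodular almost everywhere on `𝕋`. -/
def IsInnerFunction (θ : LinfT) : Prop := MemHinf θ ∧ ∀ᵐ t ∂arcMeasure, ‖θ t‖ = 1

/-- The Hardy space `H²`, as the subspace of `L²(𝕋)` of all functions whose Fourier coefficients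
of negative index vanish. -/
def hardyH2 : Submodule ℂ L2T where
  carrier := {f | ∀ n : ℤ, n < 0 → fourierCoeff (f : UCirc → ℂ) n = 0}
  zero_mem' := by
    intro n _
    rw [← fourierBasis_repr]
    simp
  add_mem' := by
    intro f g hf hg n hn
    have h1 := hf n hn
    have h2 := hg n hn
    rw [← fourierBasis_repr] at h1 h2 ⊢
    simp [h1, h2]
  smul_mem' := by
    intro c f hf n hn
    have h1 := hf n hn
    rw [← fourierBasis_repr] at h1 ⊢
    simp [h1]

/-- The operator of multiplication by `φ ∈ L^∞` on `L²`. -/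
def mulOp (φ : LinfT) : L2T →L[ℂ] L2T :=
  (ContinuousLinearMap.mul ℂ ℂ).holderL arcMeasure ∞ 2 2 φ

/-- `mulOp φ` is pointwise multiplication by `φ`. -/
theorem mulOp_coeFn (φ : LinfT) (f : L2T) :
    (mulOp φ f : UCirc → ℂ) =ᵐ[arcMeasure] fun t => φ t * f t :=
  (ContinuousLinearMap.mul ℂ ℂ).coeFn_holder φ f

/-- The model space `K_θ = H² ⊖ θ H²`. -/
def modelSpace (θ : LinfT) : Submodule ℂ L2T :=
  hardyH2 ⊓ (hardyH2.map (mulOp θ : L2T →ₗ[ℂ] L2T))ᗮ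

/-- The dual truncated Toeplitz operator `D_φ^θ f = Q_θ (φ f)` on `K_θ^⊥ = L² ⊖ K_θ`, where `Q_θ`
is the orthogonal projection of `L²` onto `K_θ^⊥`. -/
def dualTTO (θ φ : LinfT) : (modelSpace θ)ᗮ →L[ℂ] (modelSpace θ)ᗮ :=
  (modelSpace θ)ᗮ.orthogonalProjectionOnto ∘L mulOp φ ∘L (modelSpace θ)ᗮ.subtypeL

end

/-!
Write `P = H²`, `V` and `M` for multiplication by `θ` and `φ` on `L²`, and `K = P ⊖ V P` for the
model space. Since `V` is isometric and preserves `P`, `Kᗮ = Pᗮ ⊕ V P`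
(`exists_orthogonal_add_map_of_mem`). The hypothesis on `conj θ * φ` says that `φ = θ * conj h` with
`h ∈ H^∞`, and multiplication by `conj h` preserves `Pᗮ`, so `M` maps `Pᗮ` into `V Pᗮ`
(`exists_mulOp_eq_of_mem_hardyH2_orthogonal`). For `f ∈ Pᗮ` the component of `M f` in `P` is then
orthogonal to `V P`, i.e. it lies in `K` and is killed by the compression. Hence the compression of
`M` to `Kᗮ` is diagonal (`dualCompression_apply_add`): it is multiplication by `φ` on `V P`, and on
`Pᗮ` it is the compression of `M` to `Pᗮ`.

If `c` is not in the closure of `φ(𝔻)`, then `(φ - c)⁻¹ ∈ H^∞` inverts both diagonal entries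
(`notMem_spectrum_dualCompression`). If `c = φ(a)` with `a` in the disk, the Szegő kernel at `a` is
orthogonal to `(φ - c) H²` but not to the constant `1`, so `M - c` does not map `P` onto `P` and `c`
is in the spectrum (`mem_spectrum_dualCompression`). The spectrum is closed, which gives the closure.

The function theory behind this is Cauchy's formula for the boundary function of a bounded
holomorphic function (`IsHinfExtension.integral_mul_cauchyKernel`). It yields the vanishing of
the Fourier coefficients of negative index and the reproducing property of the Szegő kernel.
-/

/-! ### Cauchy's formula for boundary functions -/

theorem integral_toCircle (f : ℂ → ℂ) :
    ∫ t, f (AddCircle.toCircle t : ℂ) ∂arcMeasure = Real.circleAverage f 0 1 := by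
  have hpi : (2 * Real.pi) ≠ 0 := by positivity
  rw [AddCircle.integral_haarAddCircle, ← AddCircle.intervalIntegral_preimage 1 0,
    Real.circleAverage_def]
  have h := intervalIntegral.integral_comp_mul_left (a := 0) (b := 0 + 1)
    (fun x : ℝ => f (circleMap 0 1 x)) hpi
  simp only [mul_zero, zero_add, mul_one] at h
  rw [← h]
  simp [AddCircle.toCircle_apply_mk, circleMap, Circle.coe_exp]

theorem mul_toCircle_mem_ball {r : ℝ} (hr : r ∈ Set.Ioo (0 : ℝ) 1) (t : UCirc) :
    (r : ℂ) * (AddCircle.toCircle t : ℂ) ∈ Metric.ball (0 : ℂ) 1 := by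
  rw [mem_ball_zero_iff, norm_mul, Circle.norm_coe, mul_one, Complex.norm_of_nonneg hr.1.le]
  exact hr.2

theorem toCircle_sub_ne_zero {a : ℂ} (ha : a ∈ Metric.ball (0 : ℂ) 1) (t : UCirc) :
    (AddCircle.toCircle t : ℂ) - a ≠ 0 := by
  intro h
  have h1 : ‖a‖ = 1 := by rw [← sub_eq_zero.1 h, Circle.norm_coe]
  simp [h1] at ha

/-- The kernel of Cauchy's formula on the circle: for `a` in the disk, `z / (z - a)` with
`z = exp (2 π i t)`. -/
noncomputable def cauchyKernel (a : ℂ) (ha : a ∈ Metric.ball (0 : ℂ) 1) : C(UCirc, ℂ) where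
  toFun t := (AddCircle.toCircle t : ℂ) / ((AddCircle.toCircle t : ℂ) - a)
  continuous_toFun := by
    have h : Continuous fun t : UCirc => (AddCircle.toCircle t : ℂ) :=
      continuous_subtype_val.comp AddCircle.continuous_toCircle
    exact h.div (h.sub continuous_const) (toCircle_sub_ne_zero ha)

theorem eventually_mem_Ioo_nhdsLT_one : ∀ᶠ r in 𝓝[<] (1 : ℝ), r ∈ Set.Ioo (0 : ℝ) 1 :=
  Ioo_mem_nhdsLT one_pos

theorem IsHinfExtension.ae_norm_le {F : ℂ → ℂ} {g : UCirc → ℂ} (h : IsHinfExtension F g) :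
    ∃ C : ℝ, ∀ᵐ t ∂arcMeasure, ‖g t‖ ≤ C := by
  obtain ⟨C, hC⟩ := h.bounded
  refine ⟨C, ?_⟩
  filter_upwards [h.radial_limit] with t ht
  refine le_of_tendsto ht.norm ?_
  filter_upwards [eventually_mem_Ioo_nhdsLT_one] with r hr using hC _ (mul_toCircle_mem_ball hr t)

theorem MemHinf.memLp_top {g : UCirc → ℂ} (h : MemHinf g) (hm : AEStronglyMeasurable g arcMeasure) :
    MemLp g ∞ arcMeasure := by
  obtain ⟨F, hF⟩ := h
  obtain ⟨C, hC⟩ := hF.ae_norm_le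
  exact memLp_top_of_bound hm C hC

theorem IsHinfExtension.congr {F : ℂ → ℂ} {g g' : UCirc → ℂ} (h : IsHinfExtension F g)
    (hg : g =ᵐ[arcMeasure] g') : IsHinfExtension F g' := by
  refine ⟨h.holomorphic, h.bounded, ?_⟩
  filter_upwards [h.radial_limit, hg] with t ht ht'
  rwa [← ht']

theorem isHinfExtension_one : IsHinfExtension (fun _ => 1) (fun _ => 1) :=
  ⟨differentiableOn_const _, ⟨1, by simp⟩, by simp⟩

theorem IsHinfExtension.mul_fourier {F : ℂ → ℂ} {g : UCirc → ℂ} (h : IsHinfExtension F g)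
    (n : ℕ) : IsHinfExtension (fun z => F z * z ^ n) (fun t => g t * fourier (n : ℤ) t) := by
  obtain ⟨C, hC⟩ := h.bounded
  refine ⟨h.holomorphic.mul (differentiableOn_id.pow n), ⟨C, fun z hz => ?_⟩, ?_⟩
  · have hz1 : ‖z‖ ≤ 1 := by simpa using (Metric.mem_ball.1 hz).le
    rw [norm_mul, norm_pow]
    exact (mul_le_of_le_one_right (norm_nonneg _) (pow_le_one₀ (norm_nonneg _) hz1)).trans (hC z hz)
  · filter_upwards [h.radial_limit] with t ht
    refine ht.mul ?_
    have h2 : (fourier (n : ℤ) t : ℂ) = ((1 : ℝ) * (AddCircle.toCircle t : ℂ)) ^ n := by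
      simp [fourier_apply, AddCircle.toCircle_nsmul]
    rw [h2]
    refine tendsto_nhdsWithin_of_tendsto_nhds (Continuous.tendsto ?_ 1)
    fun_prop

/-- Off the closure of the image of the disk, `F - c` is bounded away from zero, and so are its
radial limits. -/
theorem IsHinfExtension.inv_sub {F : ℂ → ℂ} {g : UCirc → ℂ} (h : IsHinfExtension F g)
    {c : ℂ} (hc : c ∉ closure (F '' Metric.ball (0 : ℂ) 1)) :
    IsHinfExtension (fun z => (F z - c)⁻¹) (fun t => (g t - c)⁻¹) ∧
      ∀ᵐ t ∂arcMeasure, g t - c ≠ 0 := by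
  rw [Metric.mem_closure_iff] at hc
  push Not at hc
  obtain ⟨ε, hε, hc⟩ := hc
  have hF : ∀ z ∈ Metric.ball (0 : ℂ) 1, ε ≤ ‖F z - c‖ := fun z hz => by
    have := hc _ (Set.mem_image_of_mem F hz)
    rwa [dist_comm, dist_eq_norm] at this
  have hne : ∀ᵐ t ∂arcMeasure, g t - c ≠ 0 := by
    filter_upwards [h.radial_limit] with t ht
    have : ε ≤ ‖g t - c‖ := by
      refine ge_of_tendsto (ht.sub_const c).norm ?_
      filter_upwards [eventually_mem_Ioo_nhdsLT_one] with r hr using hF _ (mul_toCircle_mem_ball hr t)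
    exact norm_pos_iff.1 (hε.trans_le this)
  refine ⟨⟨?_, ⟨ε⁻¹, fun z hz => ?_⟩, ?_⟩, hne⟩
  · exact (h.holomorphic.sub_const c).inv fun z hz =>
      norm_pos_iff.1 (hε.trans_le (hF z hz))
  · rw [norm_inv]
    exact inv_anti₀ hε (hF z hz)
  · filter_upwards [h.radial_limit, hne] with t ht ht'
    exact (ht.sub_const c).inv₀ ht'

/-- Cauchy's formula for a bounded holomorphic function in terms of its radial limits: apply the
formula to the dilations `z ↦ F (r z)` and let `r → 1` by dominated convergence. -/
theorem IsHinfExtension.integral_mul_cauchyKernel {F : ℂ → ℂ} {g : UCirc → ℂ}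
    (h : IsHinfExtension F g) {a : ℂ} (ha : a ∈ Metric.ball (0 : ℂ) 1) :
    ∫ t, g t * cauchyKernel a ha t ∂arcMeasure = F a := by
  obtain ⟨C, hC⟩ := h.bounded
  have hdil : ∀ r ∈ Set.Ioo (0 : ℝ) 1,
      ∫ t, F (r * (AddCircle.toCircle t : ℂ)) * cauchyKernel a ha t ∂arcMeasure = F (r * a) := by
    intro r hr
    have hmaps : Set.MapsTo (fun z : ℂ => (r : ℂ) * z) (Metric.closedBall 0 1)
        (Metric.ball 0 1) := by
      intro z hz
      have hz : ‖z‖ ≤ 1 := by simpa using hz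
      have : r * ‖z‖ < 1 := (mul_le_of_le_one_right hr.1.le hz).trans_lt hr.2
      simpa [abs_of_pos hr.1] using this
    have hd : DifferentiableOn ℂ (fun z : ℂ => F (r * z)) (Metric.closedBall 0 1) :=
      h.holomorphic.comp (by fun_prop) hmaps
    have hd' : DiffContOnCl ℂ (fun z : ℂ => F (r * z)) (Metric.ball 0 |1|) := by
      rw [abs_one]
      exact (hd.mono (by rw [closure_ball _ one_ne_zero])).diffContOnCl
    rw [← hd'.circleAverage_smul_div (w := a) (by simpa using ha), ← integral_toCircle]
    simp [cauchyKernel, mul_comm]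
  have hlim : Tendsto (fun r : ℝ => F (r * a)) (𝓝[<] 1) (𝓝 (F a)) := by
    have hcont : ContinuousAt F ((1 : ℝ) * a) := by
      simpa using (h.holomorphic.differentiableAt (Metric.isOpen_ball.mem_nhds ha)).continuousAt
    have hm : Tendsto (fun r : ℝ => (r : ℂ) * a) (𝓝[<] 1) (𝓝 ((1 : ℝ) * a)) := by
      refine tendsto_nhdsWithin_of_tendsto_nhds (Continuous.tendsto ?_ 1)
      fun_prop
    simpa [Function.comp_def] using hcont.tendsto.comp hm
  refine tendsto_nhds_unique ?_ hlim
  have key : Tendsto (fun r : ℝ =>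
      ∫ t, F (r * (AddCircle.toCircle t : ℂ)) * cauchyKernel a ha t ∂arcMeasure) (𝓝[<] 1)
      (𝓝 (∫ t, g t * cauchyKernel a ha t ∂arcMeasure)) := by
    refine tendsto_integral_filter_of_dominated_convergence
      (fun _ => C * ‖cauchyKernel a ha‖) ?_ ?_ (integrable_const _) ?_
    · filter_upwards [eventually_mem_Ioo_nhdsLT_one] with r hr
      refine Continuous.aestronglyMeasurable ?_
      refine Continuous.mul ?_ (map_continuous _)
      refine h.holomorphic.continuousOn.comp_continuous ?_ (mul_toCircle_mem_ball hr)
      exact continuous_const.mul (continuous_subtype_val.comp AddCircle.continuous_toCircle)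
    · filter_upwards [eventually_mem_Ioo_nhdsLT_one] with r hr
      refine .of_forall fun t => ?_
      rw [norm_mul]
      have h0 := hC _ (mul_toCircle_mem_ball hr t)
      exact mul_le_mul h0 ((cauchyKernel a ha).norm_coe_le_norm t) (norm_nonneg _)
        ((norm_nonneg _).trans h0)
    · filter_upwards [h.radial_limit] with t ht using ht.mul_const _
  refine key.congr' ?_
  filter_upwards [eventually_mem_Ioo_nhdsLT_one] with r hr using hdil r hr

/-- The Fourier coefficients of negative index vanish: Cauchy's formula at `0` for `z ^ n * F z`. -/
theorem IsHinfExtension.integral_mul_fourier {F : ℂ → ℂ} {g : UCirc → ℂ}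
    (h : IsHinfExtension F g) {n : ℕ} (hn : n ≠ 0) :
    ∫ t, g t * fourier (n : ℤ) t ∂arcMeasure = 0 := by
  have := (h.mul_fourier n).integral_mul_cauchyKernel (Metric.mem_ball_self one_pos)
  simpa [cauchyKernel, hn] using this

/-! ### Compressions to the complement of a model space -/

/-- `spectrum.isClosed` for operators on an abstract Banach space; applied directly to operators on
an orthogonal complement, unifying the normed ring instances is very slow. -/
theorem isClosed_spectrum_continuousLinearMap {E : Type*} [NormedAddCommGroup E] [NormedSpace ℂ E]
    [CompleteSpace E] (A : E →L[ℂ] E) : IsClosed (spectrum ℂ A) :=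
  spectrum.isClosed A

section Compression

variable {H : Type*} [NormedAddCommGroup H] [InnerProductSpace ℂ H]

/-- `P ⊖ V P`, the abstract form of a model space (the wandering subspace of `V` on `P`). -/
noncomputable def wanderingSubspace (P : Submodule ℂ H) (V : H →L[ℂ] H) : Submodule ℂ H :=
  P ⊓ (P.map (V : H →ₗ[ℂ] H))ᗮ

variable {P : Submodule ℂ H} {V M N : H →L[ℂ] H}

theorem orthogonal_le_wanderingSubspace_orthogonal : Pᗮ ≤ (wanderingSubspace P V)ᗮ :=
  Submodule.orthogonal_le inf_le_left

theorem map_mem_wanderingSubspace_orthogonal {u : H} (hu : u ∈ P) : V u ∈ (wanderingSubspace P V)ᗮ :=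
  Submodule.orthogonal_le inf_le_right
    (Submodule.le_orthogonal_orthogonal _ (Submodule.mem_map_of_mem hu))

theorem inner_map_map_of_norm_map (hV : ∀ x, ‖V x‖ = ‖x‖) (x y : H) :
    inner ℂ (V x) (V y) = inner ℂ x y :=
  LinearIsometry.inner_map_map (⟨(V : H →ₗ[ℂ] H), hV⟩ : H →ₗᵢ[ℂ] H) x y

theorem eq_of_map_eq_of_norm_map (hV : ∀ x, ‖V x‖ = ‖x‖) {x y : H} (h : V x = V y) : x = y := by
  rw [← sub_eq_zero, ← norm_eq_zero, ← hV, map_sub, h, sub_self, norm_zero]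

theorem eq_zero_of_mem_of_mem_orthogonal {x : H} (h : x ∈ P) (h' : x ∈ Pᗮ) : x = 0 :=
  inner_self_eq_zero.1 (Submodule.inner_right_of_mem_orthogonal (𝕜 := ℂ) h h')

/-- `(P ⊖ V P)ᗮ = Pᗮ ⊕ V P`. -/
theorem exists_orthogonal_add_map_of_mem [CompleteSpace P] (hV : ∀ x, ‖V x‖ = ‖x‖) (hVP : ∀ x ∈ P, V x ∈ P)
    {f : H} (hf : f ∈ (wanderingSubspace P V)ᗮ) : ∃ p ∈ Pᗮ, ∃ u ∈ P, f = p + V u := by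
  obtain ⟨q, hq, p, hp, rfl⟩ := P.exists_add_mem_mem_orthogonal f
  have hqK : q ∈ (wanderingSubspace P V)ᗮ := by
    simpa using Submodule.sub_mem _ hf (orthogonal_le_wanderingSubspace_orthogonal hp)
  have : CompleteSpace (P.map (V : H →ₗ[ℂ] H)) :=
    LinearIsometry.completeSpace_map (⟨(V : H →ₗ[ℂ] H), hV⟩ : H →ₗᵢ[ℂ] H) P
  obtain ⟨w, hw, r, hr, rfl⟩ := (P.map (V : H →ₗ[ℂ] H)).exists_add_mem_mem_orthogonal q
  obtain ⟨u, hu, rfl⟩ := hw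
  have hrP : r ∈ P := by simpa using P.sub_mem hq (hVP u hu)
  have h1 : inner ℂ r (V u + r) = 0 := Submodule.inner_right_of_mem_orthogonal
    (K := wanderingSubspace P V) ⟨hrP, hr⟩ hqK
  have h2 : inner ℂ r (V u) = 0 :=
    Submodule.inner_left_of_mem_orthogonal (Submodule.mem_map_of_mem hu) hr
  rw [inner_add_right, h2, zero_add, inner_self_eq_zero] at h1
  exact ⟨p, hp, u, hu, by simp [h1, add_comm]⟩

variable [CompleteSpace H]

/-- The compression of `M` to `(P ⊖ V P)ᗮ`, the abstract form of a dual truncated Toeplitz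
operator. -/
noncomputable def dualCompression (P : Submodule ℂ H) (V M : H →L[ℂ] H) :
    (wanderingSubspace P V)ᗮ →L[ℂ] (wanderingSubspace P V)ᗮ :=
  (wanderingSubspace P V)ᗮ.orthogonalProjectionOnto ∘L M ∘L (wanderingSubspace P V)ᗮ.subtypeL

theorem dualCompression_apply_eq {x y : (wanderingSubspace P V)ᗮ}
    (h : M x - y ∈ wanderingSubspace P V) : dualCompression P V M x = y := by
  refine Subtype.ext ?_
  have := Submodule.eq_starProjection_of_mem_orthogonal (K := (wanderingSubspace P V)ᗮ) y.2
    (Submodule.le_orthogonal_orthogonal _ h)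
  rwa [Submodule.starProjection_apply] at this

theorem dualCompression_apply_map (hMV : ∀ x, M (V x) = V (M x)) (hMP : ∀ x ∈ P, M x ∈ P)
    {u : H} (hu : u ∈ P) :
    dualCompression P V M ⟨V u, map_mem_wanderingSubspace_orthogonal hu⟩
      = ⟨V (M u), map_mem_wanderingSubspace_orthogonal (hMP u hu)⟩ :=
  dualCompression_apply_eq (by simp [hMV])

/-- If `M Pᗮ ⊆ V Pᗮ`, then the compression of `M` acts on `Pᗮ` as the projection of `M f`
to `Pᗮ`: the remaining part of `M f` is orthogonal to `V P`, hence in `P ⊖ V P`. -/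
theorem dualCompression_apply_orthogonal
    (hV : ∀ x, ‖V x‖ = ‖x‖) (hVP : ∀ x ∈ P, V x ∈ P) (hM : ∀ x ∈ Pᗮ, ∃ w ∈ Pᗮ, M x = V w)
    {f p : H} (hf : f ∈ Pᗮ) (hp : p ∈ Pᗮ) (hfp : M f - p ∈ P) :
    dualCompression P V M ⟨f, orthogonal_le_wanderingSubspace_orthogonal hf⟩
      = ⟨p, orthogonal_le_wanderingSubspace_orthogonal hp⟩ := by
  refine dualCompression_apply_eq ⟨hfp, ?_⟩
  refine (Submodule.mem_orthogonal _ _).2 ?_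
  rintro _ ⟨u, hu, rfl⟩
  obtain ⟨w, hw, hMw⟩ := hM f hf
  have h1 : inner ℂ (V u) (M f) = 0 := by
    rw [hMw, inner_map_map_of_norm_map hV]
    exact Submodule.inner_right_of_mem_orthogonal hu hw
  have h2 : inner ℂ (V u) p = 0 := Submodule.inner_right_of_mem_orthogonal (hVP u hu) hp
  simp [inner_sub_right, h1, h2]

/-- The action of the compression on `(P ⊖ V P)ᗮ = Pᗮ ⊕ V P` is diagonal. -/
theorem dualCompression_apply_add
    (hV : ∀ x, ‖V x‖ = ‖x‖) (hVP : ∀ x ∈ P, V x ∈ P)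
    (hMV : ∀ x, M (V x) = V (M x)) (hMP : ∀ x ∈ P, M x ∈ P)
    (hM : ∀ x ∈ Pᗮ, ∃ w ∈ Pᗮ, M x = V w)
    {f p u : H} (hf : f ∈ Pᗮ) (hp : p ∈ Pᗮ) (hu : u ∈ P) (hfp : M f - p ∈ P)
    {x : (wanderingSubspace P V)ᗮ} (hx : (x : H) = f + V u) :
    (dualCompression P V M x : H) = p + V (M u) := by
  have h : x = ⟨f, orthogonal_le_wanderingSubspace_orthogonal hf⟩
      + ⟨V u, map_mem_wanderingSubspace_orthogonal hu⟩ := Subtype.ext hx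
  rw [h, map_add, dualCompression_apply_map hMV hMP hu,
    dualCompression_apply_orthogonal hV hVP hM hf hp hfp]
  rfl

variable [CompleteSpace P]

/-- If `M - c` has an inverse that preserves `P` and commutes with `V`, then the compression of
`M` minus `c` is bijective: on `V P` it is inverted by `N`, on `Pᗮ` by the compression of `N`
to `Pᗮ`. -/
theorem notMem_spectrum_dualCompression
    (hV : ∀ x, ‖V x‖ = ‖x‖) (hVP : ∀ x ∈ P, V x ∈ P)
    (hMV : ∀ x, M (V x) = V (M x)) (hMP : ∀ x ∈ P, M x ∈ P)
    (hM : ∀ x ∈ Pᗮ, ∃ w ∈ Pᗮ, M x = V w) {c : ℂ} (hNP : ∀ x ∈ P, N x ∈ P)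
    (hNM : ∀ x, N (M x - c • x) = x) (hMN : ∀ x, M (N x) - c • N x = x) :
    c ∉ spectrum ℂ (dualCompression P V M) := by
  rw [spectrum.notMem_iff, ← IsUnit.neg_iff, neg_sub, ContinuousLinearMap.isUnit_iff_bijective]
  have happ : ∀ x, (dualCompression P V M - algebraMap ℂ _ c) x
      = dualCompression P V M x - c • x := fun x => by
    simp [Algebra.algebraMap_eq_smul_one]
  constructor
  · rw [injective_iff_map_eq_zero]
    intro x hx
    rw [happ] at hx
    have hx' := congrArg (Subtype.val) hx
    obtain ⟨f, hf, u, hu, hfu⟩ := exists_orthogonal_add_map_of_mem hV hVP x.2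
    obtain ⟨q, hq, p, hp, hqp⟩ := P.exists_add_mem_mem_orthogonal (M f)
    have hD := dualCompression_apply_add hV hVP hMV hMP hM hf hp hu (by simpa [hqp] using hq) hfu
    have hsum : (p - c • f) + V (M u - c • u) = 0 := by
      rw [Submodule.coe_sub, Submodule.coe_smul, hD, hfu, Submodule.coe_zero] at hx'
      rw [← hx', map_sub, map_smul, smul_add]
      abel
    have hVm : V (M u - c • u) ∈ P := hVP _ (P.sub_mem (hMP u hu) (P.smul_mem c hu))
    have hpm : p - c • f ∈ Pᗮ := Submodule.sub_mem _ hp (Submodule.smul_mem _ c hf)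
    have h1 : p - c • f = 0 := by
      refine eq_zero_of_mem_of_mem_orthogonal (P := P) ?_ hpm
      rw [eq_neg_of_add_eq_zero_left hsum]
      exact P.neg_mem hVm
    have h2 : M u - c • u = 0 := by
      rw [h1, zero_add] at hsum
      exact eq_of_map_eq_of_norm_map hV (by rw [hsum, map_zero])
    have hu0 : u = 0 := by rw [← hNM u, h2, map_zero]
    have hf0 : f = 0 := by
      refine eq_zero_of_mem_of_mem_orthogonal (P := P) ?_ hf
      rw [← hNM f, hqp, add_sub_assoc, h1, add_zero]
      exact hNP q hq
    exact Subtype.ext (by rw [hfu, hu0, hf0]; simp)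
  · intro y
    obtain ⟨g, hg, u, hu, hgu⟩ := exists_orthogonal_add_map_of_mem hV hVP y.2
    obtain ⟨q, hq, f, hf, hqf⟩ := P.exists_add_mem_mem_orthogonal (N g)
    have hx : f + V (N u) ∈ (wanderingSubspace P V)ᗮ :=
      Submodule.add_mem _ (orthogonal_le_wanderingSubspace_orthogonal hf)
        (map_mem_wanderingSubspace_orthogonal (hNP u hu))
    refine ⟨⟨f + V (N u), hx⟩, ?_⟩
    have hMf : M f - (g + c • f) = -(M q - c • q) := by
      have h := hMN g
      rw [hqf, map_add, smul_add] at h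
      rw [← h]
      abel
    have hD := dualCompression_apply_add hV hVP hMV hMP hM hf
      (p := g + c • f) (Submodule.add_mem _ hg (Submodule.smul_mem _ c hf)) (hNP u hu)
      (by rw [hMf]; exact P.neg_mem (P.sub_mem (hMP q hq) (P.smul_mem c hq)))
      (x := ⟨f + V (N u), hx⟩) rfl
    refine Subtype.ext ?_
    rw [happ, Submodule.coe_sub, Submodule.coe_smul, hD, hgu]
    nth_rewrite 3 [← hMN u]
    rw [map_sub, map_smul, smul_add]
    abel

/-- If `M - c` does not map `P` onto `P`, then `c` is in the spectrum of the compression, since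
the restriction of the compression to `V P` is unitarily equivalent to the restriction of `M` to
`P`. -/
theorem mem_spectrum_dualCompression
    (hV : ∀ x, ‖V x‖ = ‖x‖) (hVP : ∀ x ∈ P, V x ∈ P)
    (hMV : ∀ x, M (V x) = V (M x)) (hMP : ∀ x ∈ P, M x ∈ P)
    (hM : ∀ x ∈ Pᗮ, ∃ w ∈ Pᗮ, M x = V w) {c : ℂ}
    {v : H} (hv : v ∈ P) (hne : ∀ u ∈ P, M u - c • u ≠ v) :
    c ∈ spectrum ℂ (dualCompression P V M) := by
  by_contra hc
  rw [spectrum.notMem_iff, ← IsUnit.neg_iff, neg_sub,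
    ContinuousLinearMap.isUnit_iff_bijective] at hc
  obtain ⟨x, hx⟩ := hc.2 ⟨V v, map_mem_wanderingSubspace_orthogonal hv⟩
  have hx' : (dualCompression P V M x : H) - c • (x : H) = V v := by
    simpa [Algebra.algebraMap_eq_smul_one] using congrArg Subtype.val hx
  obtain ⟨f, hf, u, hu, hfu⟩ := exists_orthogonal_add_map_of_mem hV hVP x.2
  obtain ⟨q, hq, p, hp, hqp⟩ := P.exists_add_mem_mem_orthogonal (M f)
  have hD := dualCompression_apply_add hV hVP hMV hMP hM hf hp hu (by simpa [hqp] using hq) hfu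
  refine hne u hu (eq_of_map_eq_of_norm_map hV ?_)
  have hsum : V (M u - c • u) - V v = -(p - c • f) := by
    rw [← hx', hD, hfu, map_sub, map_smul, smul_add]
    abel
  refine sub_eq_zero.1 (eq_zero_of_mem_of_mem_orthogonal (P := P) ?_ ?_)
  · exact P.sub_mem (hVP _ (P.sub_mem (hMP u hu) (P.smul_mem c hu))) (hVP v hv)
  · rw [hsum]
    exact Submodule.neg_mem _ (Submodule.sub_mem _ hp (Submodule.smul_mem _ c hf))

end Compression

/-! ### The Hardy space and multiplication operators -/

theorem inner_fourierLp_eq_fourierCoeff (f : L2T) (n : ℤ) :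
    inner ℂ (fourierLp 2 n : L2T) f = fourierCoeff (f : UCirc → ℂ) n := by
  rw [← fourierBasis_repr, HilbertBasis.repr_apply_apply, coe_fourierBasis]

theorem mem_hardyH2_iff {f : L2T} :
    f ∈ hardyH2 ↔ ∀ n : ℤ, n < 0 → inner ℂ (fourierLp 2 n : L2T) f = 0 := by
  simp_rw [inner_fourierLp_eq_fourierCoeff]
  rfl

theorem isClosed_hardyH2 : IsClosed (hardyH2 : Set L2T) := by
  have : (hardyH2 : Set L2T)
      = ⋂ n : ℤ, ⋂ _ : n < 0, {f : L2T | inner ℂ (fourierLp 2 n : L2T) f = 0} := by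
    ext f
    simp [mem_hardyH2_iff]
  rw [this]
  exact isClosed_iInter fun n => isClosed_iInter fun _ =>
    isClosed_eq (by fun_prop) continuous_const

instance : CompleteSpace hardyH2 := isClosed_hardyH2.completeSpace_coe

/-- By Parseval, `w` is orthogonal to `H²` as soon as its Fourier coefficients of nonnegative
index vanish. -/
theorem mem_hardyH2_orthogonal {w : L2T}
    (hw : ∀ n : ℕ, inner ℂ (fourierLp 2 (n : ℤ) : L2T) w = 0) : w ∈ hardyH2ᗮ := by
  refine (Submodule.mem_orthogonal _ _).2 fun u hu => ?_
  refine (fourierBasis.hasSum_inner_mul_inner u w).unique ?_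
  convert hasSum_zero with n
  rw [coe_fourierBasis]
  rcases lt_or_ge n 0 with hn | hn
  · rw [inner_eq_zero_symm.1 (mem_hardyH2_iff.1 hu n hn), zero_mul]
  · lift n to ℕ using hn
    rw [hw, mul_zero]

theorem inner_mulOp_star (g : LinfT) (u v : L2T) :
    inner ℂ (mulOp (star g) u) v = inner ℂ u (mulOp g v) := by
  rw [L2.inner_def, L2.inner_def]
  refine integral_congr_ae ?_
  filter_upwards [mulOp_coeFn (star g) u, mulOp_coeFn g v, Lp.coeFn_star g] with t h1 h2 h3
  simp only [h1, h2, h3, RCLike.inner_apply, Pi.star_apply, map_mul, RCLike.star_def,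
    RCLike.conj_conj]
  ring

theorem inner_fourierLp_mulOp_fourierLp (g : LinfT) (m n : ℤ) :
    inner ℂ (fourierLp 2 m : L2T) (mulOp g (fourierLp 2 n))
      = ∫ t, g t * fourier (n - m) t ∂arcMeasure := by
  rw [L2.inner_def]
  refine integral_congr_ae ?_
  filter_upwards [mulOp_coeFn g (fourierLp 2 n), coeFn_fourierLp 2 m,
    coeFn_fourierLp 2 n] with t h1 h2 h3
  simp only [h1, h2, h3, RCLike.inner_apply]
  rw [sub_eq_add_neg, fourier_add, fourier_neg, mul_assoc]

/-- Multiplication by `g ∈ H^∞` preserves `H²`: for `n < 0` the function `conj g * e_n` is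
orthogonal to `H²`. -/
theorem MemHinf.mulOp_mem_hardyH2 {g : LinfT} (hg : MemHinf g) {u : L2T} (hu : u ∈ hardyH2) :
    mulOp g u ∈ hardyH2 := by
  obtain ⟨F, hF⟩ := hg
  refine mem_hardyH2_iff.2 fun n hn => ?_
  rw [← inner_mulOp_star]
  refine Submodule.inner_left_of_mem_orthogonal hu (mem_hardyH2_orthogonal fun k => ?_)
  obtain ⟨m, hm⟩ : ∃ m : ℕ, (k : ℤ) - n = m := ⟨(k - n).toNat, by omega⟩
  rw [inner_eq_zero_symm, inner_mulOp_star, inner_fourierLp_mulOp_fourierLp, hm]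
  exact hF.integral_mul_fourier (by omega)

theorem norm_mulOp_of_norm_eq_one {θ : LinfT} (hθ : ∀ᵐ t ∂arcMeasure, ‖θ t‖ = 1) (f : L2T) :
    ‖mulOp θ f‖ = ‖f‖ := by
  rw [Lp.norm_def, Lp.norm_def]
  refine congrArg ENNReal.toReal (eLpNorm_congr_norm_ae ?_)
  filter_upwards [hθ, mulOp_coeFn θ f] with t h1 h2
  rw [h2, norm_mul, h1, one_mul]

theorem mulOp_comm (g h : LinfT) (f : L2T) : mulOp g (mulOp h f) = mulOp h (mulOp g f) := by
  refine Lp.ext ?_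
  filter_upwards [mulOp_coeFn g (mulOp h f), mulOp_coeFn h (mulOp g f), mulOp_coeFn g f,
    mulOp_coeFn h f] with t h1 h2 h3 h4
  rw [h1, h2, h3, h4]
  ring

/-- If `conj θ * φ` is the conjugate of an `H^∞` function, multiplication by `φ` maps
`L² ⊖ H²` into `θ (L² ⊖ H²)`. -/
theorem exists_mulOp_eq_of_mem_hardyH2_orthogonal {θ φ : LinfT}
    (hθ : ∀ᵐ t ∂arcMeasure, ‖θ t‖ = 1) (hθφ : MemConjHinf fun t => conj (θ t) * φ t)
    {f : L2T} (hf : f ∈ hardyH2ᗮ) : ∃ w ∈ hardyH2ᗮ, mulOp φ f = mulOp θ w := by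
  refine ⟨mulOp (star θ) (mulOp φ f), ?_, ?_⟩
  · have hmeas : AEStronglyMeasurable (fun t => conj (conj (θ t) * φ t)) arcMeasure :=
      RCLike.continuous_conj.comp_aestronglyMeasurable
        ((RCLike.continuous_conj.comp_aestronglyMeasurable
          (Lp.aestronglyMeasurable θ)).mul (Lp.aestronglyMeasurable φ))
    have hmem : MemLp (fun t => conj (conj (θ t) * φ t)) ∞ arcMeasure :=
      MemHinf.memLp_top hθφ hmeas
    have hh : MemHinf hmem.toLp := hθφ.imp fun F hF => hF.congr hmem.coeFn_toLp.symm
    refine (Submodule.mem_orthogonal _ _).2 fun u hu => ?_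
    rw [← Submodule.inner_right_of_mem_orthogonal (hh.mulOp_mem_hardyH2 hu) hf]
    rw [L2.inner_def, L2.inner_def]
    refine integral_congr_ae ?_
    filter_upwards [mulOp_coeFn (star θ) (mulOp φ f), mulOp_coeFn φ f, Lp.coeFn_star θ,
      mulOp_coeFn hmem.toLp u, hmem.coeFn_toLp] with t h1 h2 h3 h4 h5
    rw [h1, h2, h3, h4, h5]
    simp only [RCLike.inner_apply, Pi.star_apply, map_mul, RCLike.star_def, RCLike.conj_conj]
    ring
  · refine Lp.ext ?_
    filter_upwards [mulOp_coeFn θ (mulOp (star θ) (mulOp φ f)),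
      mulOp_coeFn (star θ) (mulOp φ f), Lp.coeFn_star θ, hθ] with t h1 h2 h3 h4
    rw [h1, h2, h3, Pi.star_apply, RCLike.star_def, ← mul_assoc, RCLike.mul_conj, h4]
    simp

/-! ### Point evaluations -/

/-- The conjugate of the Cauchy kernel as an element of `L²`; this is the Szegő kernel at `a`,
so that on `H²` the inner product with it is the evaluation at `a`. -/
noncomputable def szegoKernel (a : ℂ) (ha : a ∈ Metric.ball (0 : ℂ) 1) : L2T :=
  ContinuousMap.toLp 2 arcMeasure ℂ (star (cauchyKernel a ha))

theorem inner_szegoKernel {a : ℂ} (ha : a ∈ Metric.ball (0 : ℂ) 1) (u : L2T) :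
    inner ℂ (szegoKernel a ha) u = ∫ t, u t * cauchyKernel a ha t ∂arcMeasure := by
  rw [L2.inner_def]
  refine integral_congr_ae ?_
  filter_upwards [ContinuousMap.coeFn_toLp (p := 2) (𝕜 := ℂ) arcMeasure
    (star (cauchyKernel a ha))] with t h1
  rw [szegoKernel, h1]
  simp [RCLike.inner_apply]

theorem IsHinfExtension.inner_szegoKernel {F : ℂ → ℂ} {u : L2T} (h : IsHinfExtension F u) {a : ℂ}
    (ha : a ∈ Metric.ball (0 : ℂ) 1) : inner ℂ (szegoKernel a ha) u = F a :=
  (_root_.inner_szegoKernel ha u).trans (h.integral_mul_cauchyKernel ha)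

/-- The Szegő kernel at `a` is an eigenvector of the adjoint of multiplication by `φ` on `H²`. -/
theorem IsHinfExtension.inner_szegoKernel_mulOp {F : ℂ → ℂ} {φ : LinfT} (hφ : IsHinfExtension F φ)
    {a : ℂ} (ha : a ∈ Metric.ball (0 : ℂ) 1) {u : L2T} (hu : u ∈ hardyH2) :
    inner ℂ (szegoKernel a ha) (mulOp φ u - F a • u) = 0 := by
  -- rewrite the left side as the inner product of `conj φ * k - conj (F a) * k` with `u`, where `k`
  -- is the kernel, so that it suffices to test orthogonality to `H²` on the exponentials
  rw [inner_sub_right, ← inner_mulOp_star, inner_smul_right, ← inner_conj_symm,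
    ← inner_conj_symm (szegoKernel a ha), ← RCLike.conj_conj (F a), ← map_mul, ← map_sub,
    ← inner_smul_right, ← inner_sub_right, inner_conj_symm]
  refine Submodule.inner_left_of_mem_orthogonal hu (mem_hardyH2_orthogonal fun k => ?_)
  have h1 : IsHinfExtension (fun z => F z * z ^ k) (mulOp φ (fourierLp 2 (k : ℤ))) := by
    refine (hφ.mul_fourier k).congr ?_
    filter_upwards [mulOp_coeFn φ (fourierLp 2 (k : ℤ)), coeFn_fourierLp 2 (k : ℤ)] with t h1 h2
    rw [h1, h2]
  have h2 : IsHinfExtension (fun z => 1 * z ^ k) (fourierLp 2 (k : ℤ) : L2T) := by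
    refine (isHinfExtension_one.mul_fourier k).congr ?_
    filter_upwards [coeFn_fourierLp 2 (k : ℤ)] with t h1
    rw [h1, one_mul]
  rw [inner_eq_zero_symm, inner_sub_left, inner_smul_left, inner_mulOp_star,
    h1.inner_szegoKernel ha, h2.inner_szegoKernel ha]
  simp

/-! ### The spectrum -/

/-- Off the closure of the image of the disk, `(φ - c)⁻¹` is in `H^∞`, and multiplication by it
inverts multiplication by `φ - c`. -/
theorem IsHinfExtension.exists_mulOp_inverse {F : ℂ → ℂ} {φ : LinfT} (hφ : IsHinfExtension F φ)
    {c : ℂ} (hc : c ∉ closure (F '' Metric.ball (0 : ℂ) 1)) :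
    ∃ ψ : LinfT, MemHinf ψ ∧ (∀ x, mulOp ψ (mulOp φ x - c • x) = x) ∧
      ∀ x, mulOp φ (mulOp ψ x) - c • mulOp ψ x = x := by
  obtain ⟨hinv, hne⟩ := hφ.inv_sub hc
  have hmeas : AEStronglyMeasurable (fun t => (φ t - c)⁻¹) arcMeasure :=
    ((Lp.aestronglyMeasurable φ).aemeasurable.sub_const c).inv.aestronglyMeasurable
  have hmem : MemLp (fun t => (φ t - c)⁻¹) ∞ arcMeasure := MemHinf.memLp_top ⟨_, hinv⟩ hmeas
  obtain ⟨ψ, hψ⟩ : ∃ ψ : LinfT, ψ =ᵐ[arcMeasure] fun t => (φ t - c)⁻¹ :=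
    ⟨hmem.toLp, hmem.coeFn_toLp⟩
  have hright : ∀ x, mulOp φ (mulOp ψ x) - c • mulOp ψ x = x := fun x => by
    refine Lp.ext ?_
    filter_upwards [hne, hψ, mulOp_coeFn ψ x,
      Lp.coeFn_sub (mulOp φ (mulOp ψ x)) (c • mulOp ψ x),
      Lp.coeFn_smul c (mulOp ψ x), mulOp_coeFn φ (mulOp ψ x)]
      with t h0 h1 h2 h3 h4 h5
    rw [h3, Pi.sub_apply, h4, h5, Pi.smul_apply, h2, h1, smul_eq_mul, ← sub_mul,
      mul_inv_cancel_left₀ h0]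
  refine ⟨ψ, ⟨_, hinv.congr hψ.symm⟩, fun x => ?_, hright⟩
  rw [map_sub, map_smul, mulOp_comm ψ φ, hright]

/-- `F` is the bounded holomorphic function on the disk with boundary function `φ`, so that the
hypothesis `hφ` says that `φ ∈ H^∞`, and `F '' 𝔻` is what is meant by `φ(𝔻)`. -/
theorem theorem8p1 (θ φ : LinfT) (F : ℂ → ℂ) (hθ : IsInnerFunction θ)
    (hφ : IsHinfExtension F φ)
    (hθφ : MemConjHinf fun t => conj (θ t) * φ t) :
    spectrum ℂ (dualTTO θ φ) = closure (F '' Metric.ball (0 : ℂ) 1) := by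
  have hD : dualTTO θ φ = dualCompression hardyH2 (mulOp θ) (mulOp φ) := rfl
  have hV := norm_mulOp_of_norm_eq_one hθ.2
  have hVP : ∀ x ∈ hardyH2, mulOp θ x ∈ hardyH2 := fun x hx => hθ.1.mulOp_mem_hardyH2 hx
  have hMV := fun x => mulOp_comm φ θ x
  have hMP : ∀ x ∈ hardyH2, mulOp φ x ∈ hardyH2 :=
    fun x hx => MemHinf.mulOp_mem_hardyH2 ⟨F, hφ⟩ hx
  have hM : ∀ x ∈ hardyH2ᗮ, ∃ w ∈ hardyH2ᗮ, mulOp φ x = mulOp θ w :=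
    fun x hx => exists_mulOp_eq_of_mem_hardyH2_orthogonal hθ.2 hθφ hx
  have hsub : closure (F '' Metric.ball (0 : ℂ) 1) ⊆
      spectrum ℂ (dualCompression hardyH2 (mulOp θ) (mulOp φ)) := by
    refine closure_minimal (Set.image_subset_iff.2 fun a ha => ?_) (isClosed_spectrum_continuousLinearMap _)
    -- the constant function `1`, at which the evaluation at `a` does not vanish
    have hone : IsHinfExtension (fun z => 1 * z ^ 0) (fourierLp 2 ((0 : ℕ) : ℤ) : L2T) := by
      refine (isHinfExtension_one.mul_fourier 0).congr ?_
      filter_upwards [coeFn_fourierLp 2 ((0 : ℕ) : ℤ)] with t h1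
      rw [h1, one_mul]
    have hmem : (fourierLp 2 ((0 : ℕ) : ℤ) : L2T) ∈ hardyH2 :=
      mem_hardyH2_iff.2 fun n hn => orthonormal_fourier.2 (by simpa using hn.ne)
    refine mem_spectrum_dualCompression hV hVP hMV hMP hM hmem fun u hu hu1 => ?_
    have h0 := hφ.inner_szegoKernel_mulOp ha hu
    rw [hu1, hone.inner_szegoKernel ha] at h0
    simp at h0
  rw [hD]
  refine Set.Subset.antisymm (fun c hc => ?_) hsub
  by_contra hcF
  obtain ⟨ψ, hψ, h1, h2⟩ := hφ.exists_mulOp_inverse hcF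
  exact notMem_spectrum_dualCompression hV hVP hMV hMP hM
    (fun x hx => hψ.mulOp_mem_hardyH2 hx) h1 h2 hc
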